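/- Let $d,n\ge 1$ be integers. Let $\mathbb{R}P^d$ be the space of lines through the origin in $\mathbb{R}^{d+1}$, where the distance between two lines is the angle between them (a number in $[0,\pi/2]$), and let $$p_{n+1}(\mathbb{R}P^d)=\sup\{\varepsilon>0 : \text{there are } x_1,\dots,x_{n+1}\in\mathbb{R}P^d \text{ with } d(x_i,x_j)\ge\varepsilon \text{ for all } i\ne j\}.$$ Let $$D^{d+1}=\{(x_1,\dots,x_{d+1},0) : x_1^2+\dots+x_{d+1}^2\le 1\}\subset\mathbb{R}^{d+2},\qquad \partial D^{d+1}=\{(x_1,\dots,x_{d+1},0) : x_1^2+\dots+x_{d+1}^2=1\},$$ and for $p\in\partial D^{d+1}$ let $H^+(p)=\{x\in\mathbb{R}^{d+2}:\langle x,p\rangle\ge 0\}$ and $H^-(p)=\{x\in\mathbb{R}^{d+2}:\langle x,p\rangle\le 0\}$. For $A\subset D^{d+1}$ and $s\le t$, write $A\times[s,t]$ for the set of all $(x_1,\dots,x_{d+1},u)\in\mathbb{R}^{d+2}$ with $(x_1,\dots,x_{d+1},0)\in A$ and $s\le u\le t$. Let $A_1,\dots,A_n\subset D^{d+1}$ be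 sets that are Lebesgue measurable as subsets of $\mathbb{R}^{d+1}$. Then there exist an integer $0\le k\le n$, numbers $0=t_0\le t_1\le\dots\le t_k\le t_{k+1}=1$ and vectors $p_1,\dots,p_{k+1}\in\partial D^{d+1}$ such that 1. $\arccos\langle p_i,p_j\rangle\le \pi-p_{n+1}(\mathbb{R}P^d)$ for all $i,j$, and in particular no two of the vectors $p_i$ are antipodal; 2. the pieces $(A_j\times[t_{i-1},t_i])\cap H^+(p_i)$, $1\le i\le k+1$, equipartition each $A_j\times[0,1]$, that is, for every $j=1,\dots,n$, with $\lambda$ denoting Lebesgue measure on $\mathbb{R}^{d+2}$, $$\sum_{i=1}^{k+1}\lambda\big((A_j\times[t_{i-1},t_i])\cap H^+(p_i)\big)=\sum_{i=1}^{k+1}\lambda\big((A_j\times[t_{i-1},t_i])\cap H^-(p_i)\big).$$ -/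

import Mathlib

noncomputable section

namespace LogBundle

/-- Euclidean space `ℝ^m` with its standard norm, inner product and Lebesgue measure. -/
abbrev E (m : ℕ) := EuclideanSpace ℝ (Fin m)

/-- Real projective space `ℝP^d`: the lines through the origin of `ℝ^{d+1}`. -/
def RP (d : ℕ) := Projectivization ℝ (E (d + 1))

/-- The quotient metric of `ℝP^d = S^d / ±1`, where `S^d` carries the angular metric. It is the
angle between two lines: the smaller of the angles from a vector spanning the first line to the
two opposite directions of the second one. See `RP.dist_mk` for independence of
representatives. -/
instance RP.instDist (d : ℕ) : Dist (RP d) where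
  dist a b := min (InnerProductGeometry.angle (Projectivization.rep a) (Projectivization.rep b))
    (InnerProductGeometry.angle (Projectivization.rep a) (-Projectivization.rep b))

theorem RP.dist_mk {d : ℕ} (u v : E (d + 1)) (hu : u ≠ 0) (hv : v ≠ 0) :
    dist (α := RP d) (Projectivization.mk ℝ u hu) (Projectivization.mk ℝ v hv) =
      min (InnerProductGeometry.angle u v) (InnerProductGeometry.angle u (-v)) := by
  change min (InnerProductGeometry.angle (Projectivization.rep (Projectivization.mk ℝ u hu))
      (Projectivization.rep (Projectivization.mk ℝ v hv)))
    (InnerProductGeometry.angle (Projectivization.rep (Projectivization.mk ℝ u hu))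
      (-Projectivization.rep (Projectivization.mk ℝ v hv))) = _
  obtain ⟨a, ha⟩ := Projectivization.exists_smul_eq_mk_rep ℝ u hu
  obtain ⟨b, hb⟩ := Projectivization.exists_smul_eq_mk_rep ℝ v hv
  rw [← ha, ← hb, Units.smul_def, Units.smul_def]
  have h0a := a.ne_zero
  have h0b := b.ne_zero
  rcases lt_or_gt_of_ne h0a with h | h <;> rcases lt_or_gt_of_ne h0b with h' | h' <;>
    simp [← smul_neg, InnerProductGeometry.angle_smul_left_of_pos,
      InnerProductGeometry.angle_smul_right_of_pos, InnerProductGeometry.angle_smul_left_of_neg,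
      InnerProductGeometry.angle_smul_right_of_neg, InnerProductGeometry.angle_neg_left,
      InnerProductGeometry.angle_neg_right, min_comm, h, h']

/-- The number `p_n(X)`: the supremum of all `ε > 0` such that `X` contains `n` points
`x_1, …, x_n` at pairwise distance at least `ε`. -/
def packingNumber (X : Type) [Dist X] (n : ℕ) : ℝ :=
  sSup {ε : ℝ | 0 < ε ∧ ∃ x : Fin n → X, ∀ i j, i ≠ j → ε ≤ dist (x i) (x j)}

/-- The disk `D^{d+1} = {(x_1, …, x_{d+1}, 0) | x_1² + ⋯ + x_{d+1}² ≤ 1}` in `ℝ^{d+2}`. -/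
def disk (d : ℕ) : Set (E (d + 2)) :=
  {x | x (Fin.last (d + 1)) = 0 ∧ ∑ i : Fin (d + 1), x i.castSucc ^ 2 ≤ 1}

/-- The boundary `∂D^{d+1} = {(x_1, …, x_{d+1}, 0) | x_1² + ⋯ + x_{d+1}² = 1}`. -/
def diskBoundary (d : ℕ) : Set (E (d + 2)) :=
  {x | x (Fin.last (d + 1)) = 0 ∧ ∑ i : Fin (d + 1), x i.castSucc ^ 2 = 1}

/-- The inclusion `(x_1, …, x_{d+1}) ↦ (x_1, …, x_{d+1}, 0)` of `ℝ^{d+1}` in `ℝ^{d+2}`. -/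
def incl (d : ℕ) (x : E (d + 1)) : E (d + 2) :=
  WithLp.toLp 2 (Fin.snoc (α := fun _ => ℝ) (fun i => x i) 0)

/-- A subset of the hyperplane `ℝ^{d+1} × {0}` of `ℝ^{d+2}` is measurable if it is Lebesgue
measurable as a subset of `ℝ^{d+1}`. -/
def FlatMeasurable (d : ℕ) (A : Set (E (d + 2))) : Prop :=
  MeasureTheory.NullMeasurableSet (incl d ⁻¹' A) MeasureTheory.volume

/-- For `A` in the hyperplane `ℝ^{d+1} × {0}`, the cylinder `A × [s, t]` in `ℝ^{d+2}`: all points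
`(x_1, …, x_{d+1}, u)` with `(x_1, …, x_{d+1}, 0) ∈ A` and `u ∈ [s, t]`. -/
def cylinder {d : ℕ} (A : Set (E (d + 2))) (s t : ℝ) : Set (E (d + 2)) :=
  {x | incl d (WithLp.toLp 2 fun i => x i.castSucc) ∈ A ∧ x (Fin.last (d + 1)) ∈ Set.Icc s t}

/-- The closed half-space `H⁺(p)`. -/
def halfPos {m : ℕ} (p : E m) : Set (E m) := {x | 0 ≤ inner ℝ x p}

/-- The closed half-space `H⁻(p)`. -/
def halfNeg {m : ℕ} (p : E m) : Set (E m) := {x | inner ℝ x p ≤ 0}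

end LogBundle

end

noncomputable section

namespace LogBundle

open MeasureTheory

/-! The directions are fixed in advance, up to sign, and linear algebra does the rest. Take unit
vectors `u i` spanning `n + 1` lines whose largest mutual |cosine| `m` is minimal
(`exists_optimal_code`); then `arccos m` bounds the packing number. Each `u i` has a vector of
imbalances in `ℝ^n`, one entry per set. These `n + 1` vectors are linearly dependent; the normalised
absolute values of the coefficients become slab heights, and their signs are absorbed by replacing
`u i` with `-u i`, as imbalance is odd. Sign changes preserve |cosines|, so all inner products stay
at least `-m`. -/

theorem inner_incl {d : ℕ} (x y : E (d + 1)) :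
    inner ℝ (incl d x) (incl d y) = inner ℝ x y := by
  simp [incl, PiLp.inner_apply, Fin.sum_univ_castSucc]

theorem incl_mem_diskBoundary {d : ℕ} {u : E (d + 1)} (hu : ‖u‖ = 1) :
    incl d u ∈ diskBoundary d := by
  refine ⟨by simp [incl], ?_⟩
  have h := EuclideanSpace.real_norm_sq_eq u
  rw [hu] at h
  simpa [incl] using h.symm

theorem incl_injective (d : ℕ) : Function.Injective (incl d) := by
  intro x y h
  ext i
  simpa [incl] using congrArg (fun z : E (d + 2) => z i.castSucc) h

theorem incl_neg {d : ℕ} (x : E (d + 1)) : incl d (-x) = -incl d x := by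
  ext i
  refine Fin.lastCases ?_ (fun j => ?_) i <;> simp [incl]

/-- The largest absolute value of the inner product of two distinct members of a family. -/
def coherence {d n : ℕ} (hn : 1 ≤ n) (u : Fin (n + 1) → E (d + 1)) : ℝ :=
  (Finset.univ.offDiag : Finset (Fin (n + 1) × Fin (n + 1))).sup'
    ⟨(0, Fin.last n), by simp [Fin.ext_iff]; omega⟩ fun q => |inner ℝ (u q.1) (u q.2)|

theorem abs_inner_le_coherence {d n : ℕ} (hn : 1 ≤ n) (u : Fin (n + 1) → E (d + 1))
    {i j : Fin (n + 1)} (hij : i ≠ j) : |inner ℝ (u i) (u j)| ≤ coherence hn u :=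
  Finset.le_sup' (fun q : Fin (n + 1) × Fin (n + 1) => |inner ℝ (u q.1) (u q.2)|)
    (b := (i, j)) (by simpa using hij)

theorem coherence_le {d n : ℕ} (hn : 1 ≤ n) (u : Fin (n + 1) → E (d + 1)) {c : ℝ}
    (h : ∀ i j, i ≠ j → |inner ℝ (u i) (u j)| ≤ c) : coherence hn u ≤ c :=
  Finset.sup'_le _ _ fun q hq => h q.1 q.2 (by simpa using hq)

theorem coherence_lt {d n : ℕ} (hn : 1 ≤ n) (u : Fin (n + 1) → E (d + 1)) {c : ℝ}
    (h : ∀ i j, i ≠ j → |inner ℝ (u i) (u j)| < c) : coherence hn u < c :=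
  (Finset.sup'_lt_iff _).2 fun q hq => h q.1 q.2 (by simpa using hq)

theorem coherence_nonneg {d n : ℕ} (hn : 1 ≤ n) (u : Fin (n + 1) → E (d + 1)) :
    0 ≤ coherence hn u :=
  (abs_nonneg _).trans
    (abs_inner_le_coherence hn u (i := 0) (j := Fin.last n) (by simp [Fin.ext_iff]; omega))

theorem continuous_coherence {d n : ℕ} (hn : 1 ≤ n) :
    Continuous (coherence hn : (Fin (n + 1) → E (d + 1)) → ℝ) :=
  Continuous.finset_sup'_apply _ fun q _ =>
    ((continuous_apply q.1).inner (continuous_apply q.2)).abs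

/-- The vectors `(1, 0, …, 0, i)` are pairwise non-proportional, so Cauchy–Schwarz is strict. This
is what later excludes antipodal directions. -/
theorem exists_unit_family_coherence_lt_one {d n : ℕ} (hd : 1 ≤ d) (hn : 1 ≤ n) :
    ∃ u : Fin (n + 1) → E (d + 1), (∀ i, ‖u i‖ = 1) ∧ coherence hn u < 1 := by
  have h01 : (0 : Fin (d + 1)) ≠ Fin.last d := by simp [Fin.ext_iff]; omega
  let v : Fin (n + 1) → E (d + 1) := fun i =>
    EuclideanSpace.single 0 1 + EuclideanSpace.single (Fin.last d) (i : ℝ)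
  have hv0 : ∀ i, v i 0 = 1 := fun i => by simp [v, h01]
  have hv1 : ∀ i, v i (Fin.last d) = (i : ℝ) := fun i => by simp [v, h01.symm]
  have hv : ∀ i, v i ≠ 0 := fun i h => by simpa [h] using hv0 i
  have hu : ∀ i, ‖(‖v i‖⁻¹ • v i)‖ = 1 := fun i => norm_smul_inv_norm (𝕜 := ℝ) (hv i)
  refine ⟨fun i => ‖v i‖⁻¹ • v i, hu, coherence_lt hn _ fun i j hij => ?_⟩
  have hle := abs_real_inner_div_norm_mul_norm_le_one (v i) (v j)
  have heq : inner ℝ (‖v i‖⁻¹ • v i) (‖v j‖⁻¹ • v j) =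
      inner ℝ (v i) (v j) / (‖v i‖ * ‖v j‖) := by
    rw [real_inner_smul_left, real_inner_smul_right]
    field_simp
  rw [heq]
  refine lt_of_le_of_ne hle fun h => hij ?_
  obtain ⟨-, r, -, hr⟩ := (abs_real_inner_div_norm_mul_norm_eq_one_iff _ _).1 h
  have e0 := congrArg (fun z : E (d + 1) => z 0) hr
  have e1 := congrArg (fun z : E (d + 1) => z (Fin.last d)) hr
  simp only [PiLp.smul_apply, smul_eq_mul, hv0, hv1] at e0 e1
  rw [mul_one] at e0
  rw [← e0, one_mul] at e1
  exact Fin.ext (by exact_mod_cast e1.symm)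

theorem packingNumber_le_arccos {d n : ℕ} (hn : 1 ≤ n) {m : ℝ}
    (hm : ∀ u : Fin (n + 1) → E (d + 1), (∀ i, ‖u i‖ = 1) → m ≤ coherence hn u) :
    packingNumber (RP d) (n + 1) ≤ Real.arccos m := by
  -- Nonnegativity of the bound covers the empty set, whose `sSup` is `0`.
  refine Real.sSup_le ?_ (Real.arccos_nonneg _)
  rintro ε ⟨hε, x, hx⟩
  have hv : ∀ i, Projectivization.rep (x i) ≠ 0 := fun i => Projectivization.rep_nonzero _
  set v := fun i => Projectivization.rep (x i) with hvdef
  have hangle : ∀ i j, i ≠ j → ε ≤ InnerProductGeometry.angle (v i) (v j) ∧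
      ε ≤ Real.pi - InnerProductGeometry.angle (v i) (v j) := fun i j hij => by
    have h : ε ≤ min (InnerProductGeometry.angle (v i) (v j))
      (InnerProductGeometry.angle (v i) (-v j)) := hx i j hij
    rwa [InnerProductGeometry.angle_neg_right, le_min_iff] at h
  have hεπ : ε ≤ Real.pi := by
    obtain ⟨h, -⟩ := hangle 0 (Fin.last n) (by simp [Fin.ext_iff]; omega)
    exact h.trans (InnerProductGeometry.angle_le_pi _ _)
  have hmε : m ≤ Real.cos ε := by
    refine (hm (fun i => ‖v i‖⁻¹ • v i) fun i => norm_smul_inv_norm (𝕜 := ℝ) (hv i)).trans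
      (coherence_le hn _ fun i j hij => ?_)
    obtain ⟨h1, h2⟩ := hangle i j hij
    have heq : inner ℝ (‖v i‖⁻¹ • v i) (‖v j‖⁻¹ • v j) =
        Real.cos (InnerProductGeometry.angle (v i) (v j)) := by
      rw [InnerProductGeometry.cos_angle, real_inner_smul_left, real_inner_smul_right]
      field_simp
    rw [heq, abs_le']
    constructor
    · exact Real.cos_le_cos_of_nonneg_of_le_pi hε.le (InnerProductGeometry.angle_le_pi _ _) h1
    · rw [← Real.cos_pi_sub]
      exact Real.cos_le_cos_of_nonneg_of_le_pi hε.le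
        (by linarith [InnerProductGeometry.angle_nonneg (v i) (v j)]) h2
  rw [← Real.arccos_cos hε.le hεπ]
  exact Real.arccos_le_arccos hmε

/-- An optimal projective code: its coherence is below one and bounds the packing number. -/
theorem exists_optimal_code {d n : ℕ} (hd : 1 ≤ d) (hn : 1 ≤ n) :
    ∃ (u : Fin (n + 1) → E (d + 1)) (m : ℝ), (∀ i, ‖u i‖ = 1) ∧ 0 ≤ m ∧ m < 1 ∧
      (∀ i j, i ≠ j → |inner ℝ (u i) (u j)| ≤ m) ∧
      packingNumber (RP d) (n + 1) ≤ Real.arccos m := by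
  obtain ⟨w, hw, hw1⟩ := exists_unit_family_coherence_lt_one hd hn
  have hK : IsCompact (Set.univ.pi fun _ : Fin (n + 1) => Metric.sphere (0 : E (d + 1)) 1) :=
    isCompact_univ_pi fun _ => isCompact_sphere _ _
  obtain ⟨u, hu, hmin⟩ := hK.exists_isMinOn ⟨w, by simpa using hw⟩
    (continuous_coherence (d := d) hn).continuousOn
  refine ⟨u, coherence hn u, by simpa using hu, coherence_nonneg hn u,
    (hmin (by simpa using hw)).trans_lt hw1, fun i j hij => abs_inner_le_coherence hn u hij,
    packingNumber_le_arccos hn fun z hz => hmin (by simpa using hz)⟩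

/-- Splitting off the last coordinate turns the set into a product. For `t < s` both sides vanish.
-/
theorem volume_cylinder_inter_preimage {d : ℕ} (A : Set (E (d + 2))) (B : Set (E (d + 1)))
    (s t : ℝ) :
    volume (cylinder A s t ∩ {x | WithLp.toLp 2 (fun i : Fin (d + 1) => x i.castSucc) ∈ B}) =
      ENNReal.ofReal (t - s) * volume (incl d ⁻¹' A ∩ B) := by
  have h1 := PiLp.volume_preserving_ofLp (Fin (d + 2))
  have h2 := volume_preserving_piFinSuccAbove (fun _ : Fin (d + 2) => ℝ) (Fin.last (d + 1))
  have h3 := (MeasurePreserving.id (volume : Measure ℝ)).prod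
    (PiLp.volume_preserving_toLp (Fin (d + 1)))
  let e : E (d + 2) ≃ᵐ ℝ × E (d + 1) :=
    ((MeasurableEquiv.toLp 2 (Fin (d + 2) → ℝ)).symm.trans
      (MeasurableEquiv.piFinSuccAbove (fun _ : Fin (d + 2) => ℝ) (Fin.last (d + 1)))).trans
      ((MeasurableEquiv.refl ℝ).prodCongr (MeasurableEquiv.toLp 2 (Fin (d + 1) → ℝ)))
  have he : MeasurePreserving e volume ((volume : Measure ℝ).prod volume) :=
    h3.comp (h2.comp h1)
  have hset : cylinder A s t ∩ {x | WithLp.toLp 2 (fun i : Fin (d + 1) => x i.castSucc) ∈ B} =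
      e ⁻¹' (Set.Icc s t ×ˢ (incl d ⁻¹' A ∩ B)) := by
    ext x
    have hx : e x = (x (Fin.last (d + 1)),
        WithLp.toLp 2 (fun i : Fin (d + 1) => x i.castSucc)) := by
      refine Prod.ext rfl ?_
      ext i
      change x ((Fin.last (d + 1)).succAbove i) = _
      simp
    simp only [Set.mem_preimage, hx, Set.mem_prod, cylinder, Set.mem_inter_iff, Set.mem_ofPred_eq]
    tauto
  rw [hset, he.measure_preimage_equiv, Measure.prod_prod, Real.volume_Icc]

theorem inner_incl_right {d : ℕ} (x : E (d + 2)) (u : E (d + 1)) :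
    inner ℝ x (incl d u) = inner ℝ (WithLp.toLp 2 (fun i : Fin (d + 1) => x i.castSucc)) u := by
  simp [incl, PiLp.inner_apply, Fin.sum_univ_castSucc]

theorem volume_cylinder_inter_halfPos {d : ℕ} (A : Set (E (d + 2))) (u : E (d + 1)) (s t : ℝ) :
    volume (cylinder A s t ∩ halfPos (incl d u)) =
      ENNReal.ofReal (t - s) * volume (incl d ⁻¹' A ∩ halfPos u) := by
  rw [← volume_cylinder_inter_preimage]
  simp only [halfPos, inner_incl_right, Set.mem_ofPred_eq]

theorem volume_cylinder_inter_halfNeg {d : ℕ} (A : Set (E (d + 2))) (u : E (d + 1)) (s t : ℝ) :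
    volume (cylinder A s t ∩ halfNeg (incl d u)) =
      ENNReal.ofReal (t - s) * volume (incl d ⁻¹' A ∩ halfNeg u) := by
  rw [← volume_cylinder_inter_preimage]
  simp only [halfNeg, inner_incl_right, Set.mem_ofPred_eq]

theorem volume_preimage_incl_ne_top {d : ℕ} {A : Set (E (d + 2))} (hA : A ⊆ disk d) :
    volume (incl d ⁻¹' A) ≠ ⊤ := by
  refine measure_ne_top_of_subset (fun x hx => ?_)
    (measure_closedBall_lt_top (μ := volume) (x := (0 : E (d + 1))) (r := 1)).ne
  have h : ‖x‖ ^ 2 ≤ 1 := by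
    rw [EuclideanSpace.real_norm_sq_eq]
    simpa [incl] using (hA hx).2
  simpa using (sq_le_one_iff₀ (norm_nonneg x)).1 h

/-- The difference of the volumes of the two parts in which `u` divides `S`. -/
def imbalance {m : ℕ} (S : Set (E m)) (u : E m) : ℝ :=
  volume.real (S ∩ halfPos u) - volume.real (S ∩ halfNeg u)

theorem imbalance_neg {m : ℕ} (S : Set (E m)) (u : E m) : imbalance S (-u) = -imbalance S u := by
  simp [imbalance, halfPos, halfNeg]

/-- More than `n` vectors in `ℝ^n` satisfy a linear relation with coefficients `s_i w_i`, where
`s_i = ±1` and the `w_i` are convex weights. -/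
theorem exists_signed_convex_relation {n : ℕ} (f : Fin (n + 1) → Fin n → ℝ) :
    ∃ s w : Fin (n + 1) → ℝ, (∀ i, s i = 1 ∨ s i = -1) ∧ (∀ i, 0 ≤ w i) ∧ ∑ i, w i = 1 ∧
      ∀ j, ∑ i, w i * (s i * f i j) = 0 := by
  have hdep : ¬ LinearIndependent ℝ f := fun h => by
    have := h.fintype_card_le_finrank
    simp at this
  obtain ⟨g, hg, i₀, hi₀⟩ := Fintype.not_linearIndependent_iff.1 hdep
  have hpos : 0 < ∑ i, |g i| :=
    Finset.sum_pos' (fun i _ => abs_nonneg _) ⟨i₀, Finset.mem_univ _, abs_pos.2 hi₀⟩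
  -- Sign times weight is `g i / ∑ |g l|`.
  refine ⟨fun i => if 0 ≤ g i then 1 else -1, fun i => |g i| / ∑ l, |g l|,
    fun i => by dsimp only; split_ifs <;> simp, fun i => by positivity, ?_, fun j => ?_⟩
  · rw [← Finset.sum_div, div_self hpos.ne']
  · have hj : ∑ i, g i * f i j = 0 := by simpa using congrFun hg j
    have hj' : ∑ i, g i * f i j / ∑ l, |g l| = 0 := by rw [← Finset.sum_div, hj, zero_div]
    refine (Finset.sum_congr rfl fun i _ => ?_).trans hj'
    dsimp only
    split_ifs with h
    · rw [abs_of_nonneg h]; ring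
    · rw [abs_of_neg (not_le.1 h)]; ring

/-- Convex weights are the lengths of the intervals of a subdivision of `[0, 1]`. -/
theorem exists_subdivision {n : ℕ} (w : Fin (n + 1) → ℝ) (hw : ∀ i, 0 ≤ w i)
    (hsum : ∑ i, w i = 1) :
    ∃ t : Fin (n + 2) → ℝ, t 0 = 0 ∧ t (Fin.last (n + 1)) = 1 ∧ Monotone t ∧
      ∀ i, t i.succ - t i.castSucc = w i := by
  have hdiff : ∀ i : Fin (n + 1), (∑ l : Fin (n + 1), if l.castSucc < i.succ then w l else 0) -
      (∑ l : Fin (n + 1), if l.castSucc < i.castSucc then w l else 0) = w i := fun i => by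
    rw [← Finset.sum_sub_distrib, Finset.sum_eq_single i]
    · simp
    · intro l _ hl
      -- Consecutive partial sums differ only in the term `l = i`.
      have : l ≤ i ↔ l < i := ⟨fun h => lt_of_le_of_ne h hl, le_of_lt⟩
      simp [this, Fin.castSucc_lt_succ_iff]
    · simp
  refine ⟨fun i => ∑ l : Fin (n + 1), if l.castSucc < i then w l else 0, by simp,
    by simpa [Fin.castSucc_lt_last] using hsum, ?_, hdiff⟩
  rw [Fin.monotone_iff_le_succ]
  intro i
  linarith [hdiff i, hw i]

end LogBundle

end

open LogBundle in
theorem mainTheorem9 (d n : ℕ) (hd : 1 ≤ d) (hn : 1 ≤ n)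
    (A : Fin n → Set (LogBundle.E (d + 2)))
    (hAD : ∀ j, A j ⊆ LogBundle.disk d)
    (hA : ∀ j, LogBundle.FlatMeasurable d (A j)) :
    ∃ k : ℕ, k ≤ n ∧
    ∃ (t : Fin (k + 2) → ℝ) (p : Fin (k + 1) → LogBundle.E (d + 2)),
      t 0 = 0 ∧ t (Fin.last (k + 1)) = 1 ∧ Monotone t ∧
      (∀ i, p i ∈ LogBundle.diskBoundary d) ∧
      (∀ i j, Real.arccos (inner ℝ (p i) (p j)) ≤
        Real.pi - LogBundle.packingNumber (LogBundle.RP d) (n + 1)) ∧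
      (∀ i j, p i ≠ -p j) ∧
      (∀ j : Fin n,
        ∑ i : Fin (k + 1), MeasureTheory.volume
          (LogBundle.cylinder (A j) (t i.castSucc) (t i.succ) ∩ LogBundle.halfPos (p i)) =
        ∑ i : Fin (k + 1), MeasureTheory.volume
          (LogBundle.cylinder (A j) (t i.castSucc) (t i.succ) ∩ LogBundle.halfNeg (p i))) := by
  obtain ⟨u, m, hu, hm0, hm1, hum, hpack⟩ := exists_optimal_code hd hn
  obtain ⟨s, w, hs, hw, hwsum, hrel⟩ :=
    exists_signed_convex_relation fun i j => imbalance (incl d ⁻¹' A j) (u i)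
  obtain ⟨t, ht0, ht1, htm, htw⟩ := exists_subdivision w hw hwsum
  have habs : ∀ i, |s i| = 1 := fun i => by rcases hs i with h | h <;> simp [h]
  have hnorm : ∀ i, ‖s i • u i‖ = 1 := fun i => by
    rw [norm_smul, Real.norm_eq_abs, habs, hu, one_mul]
  have hinner : ∀ i j, -m ≤ inner ℝ (s i • u i) (s j • u j) := fun i j => by
    rcases eq_or_ne i j with rfl | hij
    · rw [real_inner_self_eq_norm_sq, hnorm]; linarith
    · refine (abs_le.1 ?_).1
      rw [real_inner_smul_left, real_inner_smul_right, abs_mul, abs_mul, habs, habs, one_mul,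
        one_mul]
      exact hum i j hij
  -- Slabs of height zero are allowed, so `k = n` always works.
  refine ⟨n, le_rfl, t, fun i => incl d (s i • u i), ht0, ht1, htm,
    fun i => incl_mem_diskBoundary (hnorm i), fun i j => ?_, fun i j h => ?_, fun j => ?_⟩
  · rw [inner_incl]
    have h := Real.arccos_le_arccos (hinner i j)
    rw [Real.arccos_neg] at h
    linarith
  · rw [← incl_neg] at h
    have h' := hinner i j
    -- Antipodal directions would have inner product `-1 < -m`.
    rw [incl_injective d h, inner_neg_left, real_inner_self_eq_norm_sq, hnorm] at h'
    linarith
  · simp only [volume_cylinder_inter_halfPos, volume_cylinder_inter_halfNeg, htw]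
    have hfin : ∀ B : Set (E (d + 1)), MeasureTheory.volume (incl d ⁻¹' A j ∩ B) ≠ ⊤ := fun B =>
      MeasureTheory.measure_ne_top_of_subset Set.inter_subset_left
        (volume_preimage_incl_ne_top (hAD j))
    have hterm : ∀ (i : Fin (n + 1)) (B : Set (E (d + 1))),
        ENNReal.ofReal (w i) * MeasureTheory.volume (incl d ⁻¹' A j ∩ B) ≠ ⊤ := fun i B =>
      ENNReal.mul_ne_top ENNReal.ofReal_ne_top (hfin B)
    -- All volumes are finite, so the equality can be checked in `ℝ`, where the difference of the
    -- sides is the relation `hrel j`.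
    rw [← ENNReal.toReal_eq_toReal_iff' (ENNReal.sum_ne_top.2 fun i _ => hterm i _)
      (ENNReal.sum_ne_top.2 fun i _ => hterm i _),
      ENNReal.toReal_sum fun i _ => hterm i _, ENNReal.toReal_sum fun i _ => hterm i _,
      ← sub_eq_zero, ← Finset.sum_sub_distrib, ← hrel j]
    refine Finset.sum_congr rfl fun i _ => ?_
    have hodd : imbalance (incl d ⁻¹' A j) (s i • u i) =
        s i * imbalance (incl d ⁻¹' A j) (u i) := by
      rcases hs i with h | h <;> simp [h, imbalance_neg]
    rw [← hodd, ENNReal.toReal_mul, ENNReal.toReal_mul, ENNReal.toReal_ofReal (hw i), ← mul_sub]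
    rfl
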